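/- Fix an infinite set of variables and a set of predicates, each with a finite arity. Formulas are built by $\phi ::= P(y_1,\dots,y_n)\mid\neg\phi\mid\phi\wedge\phi\mid[\mathsf K]\phi\mid[\mathsf K_{wh}]^x\phi$, where $[\mathsf K_{wh}]^x$ binds $x$; put $\langle\mathsf K\rangle\phi:=\neg[\mathsf K]\neg\phi$ and $[\mathsf B]\phi:=\langle\mathsf K\rangle[\mathsf K]\phi$. Whenever $\phi[y/x]$ (replace the free occurrences of $x$ by $y$) is written, $y$ is assumed admissible for $x$ in $\phi$, i.e. no free occurrence of $x$ lies in the scope of an operator $[\mathsf K_{wh}]^y$. The symbol $[\mathsf K_{wh}]$ stands for one of four operators: mention-some true belief $[\mathsf{tB}^{MS}]$, i.e. $\exists x([\mathsf B]\phi\wedge\phi)$; $[\mathsf{tB}^{MS}_{FS}]$, i.e. $\exists x([\mathsf B]\phi\wedge\phi)\wedge\forall x([\mathsf B]\phi\to\phi)$; mention-some knowledge $[\mathsf{K}^{MS}]$, i.e. $\exists x[\mathsf K]\phi$; and $[\mathsf{K}^{MS}_{FS}]$, i.e. $\exists x[\mathsf K]\phi\wedge\forall x([\mathsf B]\phi\to\phi)$.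 For each of them let $\mathbf{S4.2}^{[\mathsf K_{wh}]}$ be the set of theorems of the Hilbert system consisting of all propositional tautologies, modus ponens, necessitation for $[\mathsf K]$, the axioms $[\mathsf K](\phi\to\psi)\to([\mathsf K]\phi\to[\mathsf K]\psi)$, $[\mathsf K]\phi\to\phi$, $[\mathsf K]\phi\to[\mathsf K][\mathsf K]\phi$, $\langle\mathsf K\rangle[\mathsf K]\phi\to[\mathsf K]\langle\mathsf K\rangle\phi$, together with the following axioms and rules. Here, for a fixed choice of $n\ge 0$ and formulas $\psi_0,\dots,\psi_n$ in which $x$ is not free, $C(\chi)$ denotes $\psi_0\to[\mathsf K](\psi_1\to\cdots[\mathsf K](\psi_n\to\chi)\cdots)$. - $[\mathsf{tB}^{MS}]$: the axiom $([\mathsf B]\phi\wedge\phi)[y/x]\to[\mathsf K_{wh}]^x\phi$, and the rule from $C(\neg([\mathsf B]\phi\wedge\phi))$ infer $C(\neg[\mathsf K_{wh}]^x\phi)$. - $[\mathsf{tB}^{MS}_{FS}]$: the axioms $[\mathsf K_{wh}]^x\phi\to([\mathsf B]\phi\to\phi)[y/x]$ and $[\mathsf B]\phi[y/x]\to[\mathsf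 B][\mathsf K_{wh}]^x\phi$, the rule from $C(\neg([\mathsf B]\phi\wedge\phi))$ infer $C(\neg[\mathsf K_{wh}]^x\phi)$, and the rule from $C([\mathsf B]\phi\to\phi)$ infer $C([\mathsf B]\phi[y/x]\to[\mathsf K_{wh}]^x\phi)$. - $[\mathsf{K}^{MS}]$: the axiom $[\mathsf K]\phi[y/x]\to[\mathsf K_{wh}]^x\phi$, and the rule from $C(\neg[\mathsf K]\phi)$ infer $C(\neg[\mathsf K_{wh}]^x\phi)$. - $[\mathsf{K}^{MS}_{FS}]$: the axioms $[\mathsf K_{wh}]^x\phi\to([\mathsf B]\phi\to\phi)[y/x]$ and $[\mathsf B]\phi[y/x]\to[\mathsf B][\mathsf K_{wh}]^x\phi$, the rule from $C(\neg[\mathsf K]\phi)$ infer $C(\neg[\mathsf K_{wh}]^x\phi)$, and the rule from $C([\mathsf B]\phi\to\phi)$ infer $C([\mathsf K]\phi[y/x]\to[\mathsf K_{wh}]^x\phi)$. Then, for each of the four operators, the set $\mathbf{S4.2}^{[\mathsf K_{wh}]}_{\mathsf B}=\{\phi\mid[\mathsf B]\phi\in\mathbf{S4.2}^{[\mathsf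 K_{wh}]}\}$ is exactly the set of theorems of the system consisting of $\mathbf{S5}$ for $[\mathsf K]$ (all propositional tautologies, modus ponens, necessitation, the axioms $[\mathsf K](\phi\to\psi)\to([\mathsf K]\phi\to[\mathsf K]\psi)$, $[\mathsf K]\phi\to\phi$, $[\mathsf K]\phi\to[\mathsf K][\mathsf K]\phi$, $\neg[\mathsf K]\phi\to[\mathsf K]\neg[\mathsf K]\phi$), the axiom $[\mathsf K]\phi[y/x]\to[\mathsf K_{wh}]^x\phi$, and the rule: from $\vdash[\mathsf K]\phi\to\psi$ infer $\vdash[\mathsf K_{wh}]^x\phi\to\psi$, where $x$ is not free in $\psi$. Hence, written with the common symbol $[\mathsf K_{wh}]$, it is the same set for all four operators; and it is the $\mathbf{S5}$ logic of mention-some knowledge, i.e. the set of formulas true at every world under every assignment in all first-order Kripke models with constant non-empty domain whose accessibility relation is an equivalence relation, when $[\mathsf K_{wh}]^x\phi$ is read as $\exists x[\mathsf K]\phi$. -/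

import Mathlib

universe u

namespace KnowWh

/-- Formulas of the language with propositional knowledge `[K]` and one bundled operator
`[K_wh]^x`. The four languages of the four accounts differ only in how the symbol `[K_wh]` is read
(see `WhOp`), so they share this syntax. `ar p` is the arity of the predicate `p`. -/
inductive Form (Var Pred : Type u) (ar : Pred → ℕ) : Type u
  | atom (p : Pred) (ys : Fin (ar p) → Var) : Form Var Pred ar
  | neg (φ : Form Var Pred ar) : Form Var Pred ar
  | and (φ ψ : Form Var Pred ar) : Form Var Pred ar
  | K (φ : Form Var Pred ar) : Form Var Pred ar
  | wh (x : Var) (φ : Form Var Pred ar) : Form Var Pred ar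

/-- The four accounts of knowledge-wh:
mention-some true belief, the same with false-belief sensitivity,
mention-some knowledge, the same with false-belief sensitivity. -/
inductive WhOp
  | tBMS
  | tBMSFS
  | KMS
  | KMSFS

namespace Form

variable {Var Pred : Type u} {ar : Pred → ℕ}

/-- Material implication `φ → ψ`. -/
def imp (φ ψ : Form Var Pred ar) : Form Var Pred ar := neg (and φ (neg ψ))

/-- `⟨K⟩ φ`. -/
def dia (φ : Form Var Pred ar) : Form Var Pred ar := neg (K (neg φ))

/-- Belief: `[B] φ` abbreviates `⟨K⟩ [K] φ`. -/
def B (φ : Form Var Pred ar) : Form Var Pred ar := dia (K φ)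

/-- Free variables; `[K_wh]^x` binds `x`. -/
def fv : Form Var Pred ar → Set Var
  | atom _ ys => Set.range ys
  | neg φ => fv φ
  | and φ ψ => fv φ ∪ fv ψ
  | K φ => fv φ
  | wh x φ => fv φ \ {x}

/-- `subst x y φ` is `φ[y/x]`: every free occurrence of `x` is replaced by `y`. -/
def subst [DecidableEq Var] (x y : Var) : Form Var Pred ar → Form Var Pred ar
  | atom p ys => atom p (fun i => if ys i = x then y else ys i)
  | neg φ => neg (subst x y φ)
  | and φ ψ => and (subst x y φ) (subst x y ψ)
  | K φ => K (subst x y φ)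
  | wh z φ => if z = x then wh z φ else wh z (subst x y φ)

/-- `y` is admissible for `x` in `φ`: no free occurrence of `x` in `φ` lies in the scope of an
operator `[K_wh]^y`. -/
def Admissible (x y : Var) : Form Var Pred ar → Prop
  | atom _ _ => True
  | neg φ => Admissible x y φ
  | and φ ψ => Admissible x y φ ∧ Admissible x y ψ
  | K φ => Admissible x y φ
  | wh z φ => x ∉ fv (wh z φ) ∨ (z ≠ y ∧ Admissible x y φ)

/-- Evaluation under a valuation `v` of the propositionally atomic formulas
(atoms, `[K] φ` and `[K_wh]^x φ`). -/
def peval (v : Form Var Pred ar → Prop) : Form Var Pred ar → Prop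
  | neg φ => ¬ peval v φ
  | and φ ψ => peval v φ ∧ peval v ψ
  | atom p ys => v (atom p ys)
  | K φ => v (K φ)
  | wh x φ => v (wh x φ)

/-- Instances of propositional tautologies. -/
def IsTaut (φ : Form Var Pred ar) : Prop := ∀ v : Form Var Pred ar → Prop, peval v φ

/-- `chain ψ₀ [ψ₁, …, ψₙ] χ` is `ψ₀ → [K](ψ₁ → ⋯ [K](ψₙ → χ) ⋯)`. -/
def chain : Form Var Pred ar → List (Form Var Pred ar) → Form Var Pred ar → Form Var Pred ar
  | ψ, [], χ => imp ψ χ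
  | ψ, ψ' :: l, χ => imp ψ (K (chain ψ' l χ))

end Form

section Systems

open Form

variable {Var Pred : Type u} {ar : Pred → ℕ}

/-- Theorems of the Hilbert system with all propositional tautologies, modus ponens, necessitation
for `[K]`, the further axioms `Ax`, and the further one-premise rules `Ru`
(`Ru premise conclusion`). -/
inductive Derivable (Ax : Set (Form Var Pred ar))
    (Ru : Form Var Pred ar → Form Var Pred ar → Prop) : Form Var Pred ar → Prop
  | taut {φ : Form Var Pred ar} : IsTaut φ → Derivable Ax Ru φ
  | ax {φ : Form Var Pred ar} : φ ∈ Ax → Derivable Ax Ru φ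
  | mp {φ ψ : Form Var Pred ar} : Derivable Ax Ru (imp φ ψ) → Derivable Ax Ru φ → Derivable Ax Ru ψ
  | nec {φ : Form Var Pred ar} : Derivable Ax Ru φ → Derivable Ax Ru (K φ)
  | rule {φ ψ : Form Var Pred ar} : Ru φ ψ → Derivable Ax Ru φ → Derivable Ax Ru ψ

/-- `[K](φ → ψ) → ([K]φ → [K]ψ)`. -/
def axDist : Set (Form Var Pred ar) := {χ | ∃ φ ψ, χ = imp (K (imp φ ψ)) (imp (K φ) (K ψ))}

/-- `[K]φ → φ`. -/
def axT : Set (Form Var Pred ar) := {χ | ∃ φ, χ = imp (K φ) φ}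

/-- `[K]φ → [K][K]φ`. -/
def axFour : Set (Form Var Pred ar) := {χ | ∃ φ, χ = imp (K φ) (K (K φ))}

/-- `⟨K⟩[K]φ → [K]⟨K⟩φ`. -/
def axDotTwo : Set (Form Var Pred ar) := {χ | ∃ φ, χ = imp (dia (K φ)) (K (dia φ))}

/-- `¬[K]φ → [K]¬[K]φ`. -/
def axFive : Set (Form Var Pred ar) := {χ | ∃ φ, χ = imp (neg (K φ)) (K (neg (K φ)))}

/-- Axioms of **S4.2** for `[K]`. -/
def axS42 : Set (Form Var Pred ar) := axDist ∪ axT ∪ axFour ∪ axDotTwo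

/-- Axioms of **S5** for `[K]`. -/
def axS5 : Set (Form Var Pred ar) := axDist ∪ axT ∪ axFour ∪ axFive

/-- `([B]φ ∧ φ)[y/x] → [K_wh]^x φ`. -/
def TBtoKwh [DecidableEq Var] : Set (Form Var Pred ar) :=
  {χ | ∃ x y φ, Admissible x y φ ∧ χ = imp (subst x y (and (B φ) φ)) (wh x φ)}

/-- `[K]φ[y/x] → [K_wh]^x φ`. -/
def KtoKwh [DecidableEq Var] : Set (Form Var Pred ar) :=
  {χ | ∃ x y φ, Admissible x y φ ∧ χ = imp (K (subst x y φ)) (wh x φ)}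

/-- `[K_wh]^x φ → ([B]φ → φ)[y/x]`. -/
def KwhtoFS [DecidableEq Var] : Set (Form Var Pred ar) :=
  {χ | ∃ x y φ, Admissible x y φ ∧ χ = imp (wh x φ) (subst x y (imp (B φ) φ))}

/-- `[B]φ[y/x] → [B][K_wh]^x φ`. -/
def BtoBKwh [DecidableEq Var] : Set (Form Var Pred ar) :=
  {χ | ∃ x y φ, Admissible x y φ ∧ χ = imp (B (subst x y φ)) (B (wh x φ))}

/-- From `ψ₀ → [K](ψ₁ → ⋯ [K](ψₙ → ¬([B]φ ∧ φ)) ⋯)`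
infer `ψ₀ → [K](ψ₁ → ⋯ [K](ψₙ → ¬[K_wh]^x φ) ⋯)`, for `x` not free in any `ψᵢ`. -/
def KwhtoTB (prem concl : Form Var Pred ar) : Prop :=
  ∃ (ψ : Form Var Pred ar) (l : List (Form Var Pred ar)) (x : Var) (φ : Form Var Pred ar),
    (∀ θ ∈ ψ :: l, x ∉ fv θ) ∧
    prem = chain ψ l (neg (and (B φ) φ)) ∧ concl = chain ψ l (neg (wh x φ))

/-- From `ψ₀ → [K](ψ₁ → ⋯ [K](ψₙ → ¬[K]φ) ⋯)`
infer `ψ₀ → [K](ψ₁ → ⋯ [K](ψₙ → ¬[K_wh]^x φ) ⋯)`, for `x` not free in any `ψᵢ`. -/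
def KwhtoK (prem concl : Form Var Pred ar) : Prop :=
  ∃ (ψ : Form Var Pred ar) (l : List (Form Var Pred ar)) (x : Var) (φ : Form Var Pred ar),
    (∀ θ ∈ ψ :: l, x ∉ fv θ) ∧
    prem = chain ψ l (neg (K φ)) ∧ concl = chain ψ l (neg (wh x φ))

/-- From `ψ₀ → [K](ψ₁ → ⋯ [K](ψₙ → ([B]φ → φ)) ⋯)`
infer `ψ₀ → [K](ψ₁ → ⋯ [K](ψₙ → ([B]φ[y/x] → [K_wh]^x φ)) ⋯)`, for `x` not free in any `ψᵢ`. -/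
def FSBtoKwh [DecidableEq Var] (prem concl : Form Var Pred ar) : Prop :=
  ∃ (ψ : Form Var Pred ar) (l : List (Form Var Pred ar)) (x y : Var) (φ : Form Var Pred ar),
    (∀ θ ∈ ψ :: l, x ∉ fv θ) ∧ Admissible x y φ ∧
    prem = chain ψ l (imp (B φ) φ) ∧ concl = chain ψ l (imp (B (subst x y φ)) (wh x φ))

/-- From `ψ₀ → [K](ψ₁ → ⋯ [K](ψₙ → ([B]φ → φ)) ⋯)`
infer `ψ₀ → [K](ψ₁ → ⋯ [K](ψₙ → ([K]φ[y/x] → [K_wh]^x φ)) ⋯)`, for `x` not free in any `ψᵢ`. -/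
def FSKtoKwh [DecidableEq Var] (prem concl : Form Var Pred ar) : Prop :=
  ∃ (ψ : Form Var Pred ar) (l : List (Form Var Pred ar)) (x y : Var) (φ : Form Var Pred ar),
    (∀ θ ∈ ψ :: l, x ∉ fv θ) ∧ Admissible x y φ ∧
    prem = chain ψ l (imp (B φ) φ) ∧ concl = chain ψ l (imp (K (subst x y φ)) (wh x φ))

/-- From `[K]φ → ψ` infer `[K_wh]^x φ → ψ`, for `x` not free in `ψ`. -/
def KwhtoKZero (prem concl : Form Var Pred ar) : Prop :=
  ∃ (x : Var) (φ ψ : Form Var Pred ar),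
    x ∉ fv ψ ∧ prem = imp (K φ) ψ ∧ concl = imp (wh x φ) ψ

/-- The axioms for `[K_wh]` in each of the four logics. -/
def whAxioms [DecidableEq Var] : WhOp → Set (Form Var Pred ar)
  | .tBMS => TBtoKwh
  | .tBMSFS => KwhtoFS ∪ BtoBKwh
  | .KMS => KtoKwh
  | .KMSFS => KwhtoFS ∪ BtoBKwh

/-- The rules for `[K_wh]` in each of the four logics. -/
def whRules [DecidableEq Var] : WhOp → Form Var Pred ar → Form Var Pred ar → Prop
  | .tBMS => KwhtoTB
  | .tBMSFS => fun α β => KwhtoTB α β ∨ FSBtoKwh α β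
  | .KMS => KwhtoK
  | .KMSFS => fun α β => KwhtoK α β ∨ FSKtoKwh α β

end Systems

/-- The logic **S4.2**`^[K_wh]`, as its set of theorems. -/
def S42Wh (Var Pred : Type u) (ar : Pred → ℕ) [DecidableEq Var] (o : WhOp) :
    Set (Form Var Pred ar) :=
  {φ | Derivable (axS42 ∪ whAxioms o) (whRules o) φ}

/-- The set of theorems of **S5** for `[K]` plus `[K]φ[y/x] → [K_wh]^x φ` plus the rule
`KwhtoKZero`. -/
def S5Wh (Var Pred : Type u) (ar : Pred → ℕ) [DecidableEq Var] : Set (Form Var Pred ar) :=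
  {φ | Derivable (axS5 ∪ KtoKwh) KwhtoKZero φ}

/-- `L_B = {φ | [B]φ ∈ L}`. -/
def believed {Var Pred : Type u} {ar : Pred → ℕ} (L : Set (Form Var Pred ar)) :
    Set (Form Var Pred ar) :=
  {φ | Form.B φ ∈ L}

section Semantics

/-- First-order Kripke models with a constant domain. -/
structure Model (Pred : Type u) (ar : Pred → ℕ) where
  W : Type u
  D : Type u
  nonempty_W : Nonempty W
  nonempty_D : Nonempty D
  R : W → W → Prop
  ρ : (p : Pred) → W → Set (Fin (ar p) → D)

/-- Truth of `[K]` at `w` for the condition `S`. -/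
def KHolds {W : Type u} (R : W → W → Prop) (w : W) (S : W → Prop) : Prop := ∀ v, R w v → S v

/-- Truth of `[B] = ⟨K⟩[K]` at `w` for the condition `S`. -/
def BHolds {W : Type u} (R : W → W → Prop) (w : W) (S : W → Prop) : Prop :=
  ∃ v, R w v ∧ KHolds R v S

/-- Truth of `[K_wh]^x φ` at `w` under each of the four readings, where `S a v` says that `φ` is
true at `v` when `x` denotes `a`. -/
def WhOp.Holds {W D : Type u} (R : W → W → Prop) (w : W) (S : D → W → Prop) : WhOp → Prop
  | .tBMS => ∃ a, BHolds R w (S a) ∧ S a w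
  | .tBMSFS => (∃ a, BHolds R w (S a) ∧ S a w) ∧ ∀ b, BHolds R w (S b) → S b w
  | .KMS => ∃ a, KHolds R w (S a)
  | .KMSFS => (∃ a, KHolds R w (S a)) ∧ ∀ b, BHolds R w (S b) → S b w

variable {Var Pred : Type u} {ar : Pred → ℕ}

/-- Truth of a formula at a world under an assignment, with `[K_wh]` read as `o`. -/
def Model.Sat [DecidableEq Var] (M : Model Pred ar) (o : WhOp) :
    Form Var Pred ar → M.W → (Var → M.D) → Prop
  | .atom p ys, w, σ => (fun i => σ (ys i)) ∈ M.ρ p w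
  | .neg φ, w, σ => ¬ M.Sat o φ w σ
  | .and φ ψ, w, σ => M.Sat o φ w σ ∧ M.Sat o ψ w σ
  | .K φ, w, σ => KHolds M.R w (fun v => M.Sat o φ v σ)
  | .wh x φ, w, σ => o.Holds M.R w (fun a v => M.Sat o φ v (Function.update σ x a))

/-- Validity on all models whose accessibility relation is an equivalence relation, with `[K_wh]`
read as `o`. -/
def ValidS5 [DecidableEq Var] (o : WhOp) (φ : Form Var Pred ar) : Prop :=
  ∀ M : Model.{u} Pred ar, Equivalence M.R →
    ∀ (w : M.W) (σ : Var → M.D), M.Sat o φ w σ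

end Semantics

end KnowWh

namespace KnowWh

open Form

/-! ### Derived modal laws of knowledge and belief -/

section Calculus

variable {Var Pred : Type u} {ar : Pred → ℕ}

/-! The proof is a cycle of inclusions: theorems of the S5 system ⊆ believed formulas ⊆ formulas
valid on equivalence relations under the mention-some reading ⊆ theorems of the S5 system. The last
two sets do not depend on the operator, so neither do the believed formulas.

For the first inclusion, S4.2 makes both belief and its absence known, so belief is closed under
modus ponens and necessitation; negative introspection is believed because either `B φ` or `K (neg
(K φ))` holds. The two S5 principles for `[K_wh]` are obtained by the same case split. In
particular, a believed `K φ → ψ` becomes "if ψ is not believed, then φ is known not to be known (or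
truly believed)", which is a premise of the `[K_wh]`-rules (`chain_neg_B`, `B_imp_of_chain`).

For the second, belief coincides with knowledge on an equivalence relation. Belief is then factive,
false-belief sensitivity is vacuous, the four accounts collapse into `∃x[K]φ`, and all four systems
are sound for it (`validS5_of_mem_S42Wh`).

The third is a Henkin completeness proof. Variables and predicates may be uncountably many, so
witnesses are supplied only for the countably many instances of subformulas `[K_wh]^x θ` of the
given formula, over a countable domain of variables that avoids its bound ones
(`exists_isMaxCons_witness`, `canonicalModel_sat`). Since `[K_wh]^x φ` is itself known, witnesses
placed in one maximal consistent set serve every world that shares its knowledge. Formulas with a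
variable both free and bound are reduced to the others by renaming (`thm_of_validS5`). -/

@[simp]
theorem peval_neg (v : Form Var Pred ar → Prop) (φ : Form Var Pred ar) :
    peval v (neg φ) ↔ ¬ peval v φ := Iff.rfl

@[simp]
theorem peval_and (v : Form Var Pred ar → Prop) (φ ψ : Form Var Pred ar) :
    peval v (and φ ψ) ↔ peval v φ ∧ peval v ψ := Iff.rfl

@[simp]
theorem peval_imp (v : Form Var Pred ar → Prop) (φ ψ : Form Var Pred ar) :
    peval v (imp φ ψ) ↔ (peval v φ → peval v ψ) := by
  simp [imp]

@[simp]
theorem peval_dia (v : Form Var Pred ar → Prop) (φ : Form Var Pred ar) :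
    peval v (dia φ) ↔ ¬ peval v (K (neg φ)) := Iff.rfl

@[simp]
theorem peval_B (v : Form Var Pred ar → Prop) (φ : Form Var Pred ar) :
    peval v (B φ) ↔ ¬ peval v (K (neg (K φ))) := Iff.rfl

variable {Ax : Set (Form Var Pred ar)} {Ru : Form Var Pred ar → Form Var Pred ar → Prop}
  {α β γ φ ψ χ : Form Var Pred ar}

namespace Derivable

theorem conseq (h : Derivable Ax Ru α) (t : ∀ v, peval v α → peval v φ) : Derivable Ax Ru φ :=
  mp (taut fun v => (peval_imp v α φ).2 (t v)) h

theorem conseq₂ (h₁ : Derivable Ax Ru α) (h₂ : Derivable Ax Ru β)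
    (t : ∀ v, peval v α → peval v β → peval v φ) : Derivable Ax Ru φ :=
  mp (conseq h₁ fun v h => (peval_imp v β φ).2 (t v h)) h₂

theorem conseq₃ (h₁ : Derivable Ax Ru α) (h₂ : Derivable Ax Ru β) (h₃ : Derivable Ax Ru γ)
    (t : ∀ v, peval v α → peval v β → peval v γ → peval v φ) : Derivable Ax Ru φ :=
  mp (conseq₂ h₁ h₂ fun v h h' => (peval_imp v γ φ).2 (t v h h')) h₃

theorem trans (h₁ : Derivable Ax Ru (imp α β)) (h₂ : Derivable Ax Ru (imp β γ)) :
    Derivable Ax Ru (imp α γ) :=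
  conseq₂ h₁ h₂ fun v => by simp only [peval_imp]; tauto

theorem dist (hd : axDist ⊆ Ax) (φ ψ : Form Var Pred ar) :
    Derivable Ax Ru (imp (K (imp φ ψ)) (imp (K φ) (K ψ))) := ax (hd ⟨φ, ψ, rfl⟩)

theorem K_mono (hd : axDist ⊆ Ax) (h : Derivable Ax Ru (imp φ ψ)) :
    Derivable Ax Ru (imp (K φ) (K ψ)) := mp (dist hd φ ψ) (nec h)

theorem K_mono_taut (hd : axDist ⊆ Ax) (t : ∀ v, peval v φ → peval v ψ) :
    Derivable Ax Ru (imp (K φ) (K ψ)) := K_mono hd (taut fun v => (peval_imp v φ ψ).2 (t v))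

theorem dia_mono (hd : axDist ⊆ Ax) (h : Derivable Ax Ru (imp φ ψ)) :
    Derivable Ax Ru (imp (dia φ) (dia ψ)) := by
  have h₁ : Derivable Ax Ru (imp (K (neg ψ)) (K (neg φ))) :=
    K_mono hd (conseq h fun v => by simp only [peval_imp, peval_neg]; tauto)
  exact conseq h₁ fun v => by simp only [peval_imp, peval_dia]; tauto

theorem B_mono (hd : axDist ⊆ Ax) (h : Derivable Ax Ru (imp φ ψ)) :
    Derivable Ax Ru (imp (B φ) (B ψ)) := dia_mono hd (K_mono hd h)

theorem B_mono_taut (hd : axDist ⊆ Ax) (t : ∀ v, peval v φ → peval v ψ) :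
    Derivable Ax Ru (imp (B φ) (B ψ)) := B_mono hd (taut fun v => (peval_imp v φ ψ).2 (t v))

/-- What is known is believed. -/
theorem K_imp_B (hT : axT ⊆ Ax) (φ : Form Var Pred ar) : Derivable Ax Ru (imp (K φ) (B φ)) := by
  have h : Derivable Ax Ru (imp (K (neg (K φ))) (neg (K φ))) := ax (hT ⟨_, rfl⟩)
  exact conseq h fun v => by simp only [peval_imp, peval_B, peval_neg]; tauto

theorem believe (hT : axT ⊆ Ax) (h : Derivable Ax Ru φ) : Derivable Ax Ru (B φ) :=
  mp (K_imp_B hT φ) (nec h)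

/-- Disbelief is known. -/
theorem neg_B_imp_K (hd : axDist ⊆ Ax) (h4 : axFour ⊆ Ax) (φ : Form Var Pred ar) :
    Derivable Ax Ru (imp (neg (B φ)) (K (neg (B φ)))) := by
  have h₁ : Derivable Ax Ru (imp (K (neg (K φ))) (K (K (neg (K φ))))) := ax (h4 ⟨_, rfl⟩)
  have h₂ : Derivable Ax Ru (imp (K (K (neg (K φ)))) (K (neg (B φ)))) :=
    K_mono_taut hd fun v => by simp
  exact conseq₂ h₁ h₂ fun v => by simp only [peval_imp, peval_B, peval_neg]; tauto

theorem B_imp_BK (hd : axDist ⊆ Ax) (h4 : axFour ⊆ Ax) (φ : Form Var Pred ar) :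
    Derivable Ax Ru (imp (B φ) (B (K φ))) := dia_mono hd (ax (h4 ⟨φ, rfl⟩))

/-- Belief is known. -/
theorem B_imp_KB (hd : axDist ⊆ Ax) (h4 : axFour ⊆ Ax) (h2 : axDotTwo ⊆ Ax)
    (φ : Form Var Pred ar) : Derivable Ax Ru (imp (B φ) (K (B φ))) :=
  trans (B_imp_BK hd h4 φ) (ax (h2 ⟨K φ, rfl⟩))

/-- Belief is closed under believed implication. -/
theorem B_dist (hd : axDist ⊆ Ax) (h4 : axFour ⊆ Ax) (h2 : axDotTwo ⊆ Ax)
    (φ ψ : Form Var Pred ar) : Derivable Ax Ru (imp (B (imp φ ψ)) (imp (B φ) (B ψ))) := by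
  have h₁ : Derivable Ax Ru (imp (K (imp φ ψ)) (imp (B φ) (B ψ))) := by
    have a₁ : Derivable Ax Ru (imp (K (imp φ ψ)) (K (K (imp φ ψ)))) := ax (h4 ⟨_, rfl⟩)
    have a₂ : Derivable Ax Ru (imp (K (imp φ ψ)) (imp (neg (K ψ)) (neg (K φ)))) :=
      conseq (dist hd φ ψ) fun v => by simp only [peval_imp, peval_neg]; tauto
    have a₃ := trans (trans a₁ (K_mono hd a₂)) (dist hd _ _)
    exact conseq a₃ fun v => by simp only [peval_imp, peval_B]; tauto
  -- Contrapositive: if φ is believed and ψ is not, both facts are known; by `h₁` it is then known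
  -- that `imp φ ψ` is not known, so `imp φ ψ` is not believed.
  have h₂ : Derivable Ax Ru
      (imp (K (B φ)) (imp (K (neg (B ψ))) (K (neg (K (imp φ ψ)))))) := by
    have a : Derivable Ax Ru (imp (B φ) (imp (neg (B ψ)) (neg (K (imp φ ψ))))) :=
      conseq h₁ fun v => by simp only [peval_imp, peval_neg]; tauto
    exact trans (K_mono hd a) (dist hd _ _)
  refine conseq₃ h₂ (B_imp_KB hd h4 h2 φ) (neg_B_imp_K hd h4 ψ) fun v => ?_
  simp only [peval_imp, peval_neg, peval_B v (imp φ ψ)]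
  tauto

/-- Negative introspection is believed. -/
theorem B_five (hd : axDist ⊆ Ax) (hT : axT ⊆ Ax) (h4 : axFour ⊆ Ax) (φ : Form Var Pred ar) :
    Derivable Ax Ru (B (imp (neg (K φ)) (K (neg (K φ))))) := by
  -- Split on `B φ`. If it holds, `K φ` is believed and refutes the antecedent; if it fails, `K (neg
  -- (K φ))` holds, hence is believed, and gives the consequent.
  have h₁ : Derivable Ax Ru (imp (B φ) (B (imp (neg (K φ)) (K (neg (K φ)))))) :=
    trans (B_imp_BK hd h4 φ) (B_mono_taut hd fun v => by simp only [peval_imp, peval_neg]; tauto)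
  have h₂ : Derivable Ax Ru
      (imp (K (neg (K φ))) (B (imp (neg (K φ)) (K (neg (K φ)))))) :=
    trans (trans (ax (h4 ⟨_, rfl⟩)) (K_imp_B hT _))
      (B_mono_taut hd fun v => by simp only [peval_imp, peval_neg]; tauto)
  refine conseq₂ h₁ h₂ fun v => ?_
  simp only [peval_imp, peval_B v φ]
  tauto

/-- If `[B]φ → [B]χ` is derivable, so is the belief in `[K]φ → χ`. -/
theorem B_K_imp (hd : axDist ⊆ Ax) (hT : axT ⊆ Ax) (h : Derivable Ax Ru (imp (B φ) (B χ))) :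
    Derivable Ax Ru (B (imp (K φ) χ)) := by
  have h₁ : Derivable Ax Ru (imp (B χ) (B (imp (K φ) χ))) :=
    B_mono_taut hd fun v => by simp only [peval_imp]; tauto
  have h₂ : Derivable Ax Ru (imp (K (neg (K φ))) (B (imp (K φ) χ))) :=
    trans (K_imp_B hT _) (B_mono_taut hd fun v => by simp only [peval_imp, peval_neg]; tauto)
  refine conseq₃ h h₁ h₂ fun v => ?_
  simp only [peval_imp, peval_B v φ]
  tauto

/-- If `[K]φ → ψ` is believed and `χ` implies `[B]φ`, then not believing `ψ` implies knowing that
`χ` is false. -/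
theorem chain_neg_B (hd : axDist ⊆ Ax) (h4 : axFour ⊆ Ax) (h2 : axDotTwo ⊆ Ax)
    (h : Derivable Ax Ru (B (imp (K φ) ψ))) (t : Derivable Ax Ru (imp χ (B φ))) :
    Derivable Ax Ru (chain (neg (B ψ)) [imp ψ ψ] (neg χ)) := by
  -- The entry `imp ψ ψ` of the chain is a verum that introduces no variable outside ψ.
  have h₁ : Derivable Ax Ru (imp (B φ) (B ψ)) :=
    trans (B_imp_BK hd h4 φ) (mp (B_dist hd h4 h2 _ _) h)
  exact trans (neg_B_imp_K hd h4 ψ) (K_mono hd (conseq₂ h₁ t fun v => by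
    simp only [chain, peval_imp, peval_neg]; tauto))

/-- Split on `B ψ`: if ψ is believed, so is the weaker `imp χ ψ`; otherwise the chain gives
knowledge of `neg χ`, which also yields that belief. -/
theorem B_imp_of_chain (hd : axDist ⊆ Ax) (hT : axT ⊆ Ax)
    (h : Derivable Ax Ru (chain (neg (B ψ)) [imp ψ ψ] (neg χ))) :
    Derivable Ax Ru (B (imp χ ψ)) := by
  have h₁ : Derivable Ax Ru (imp (K (imp (imp ψ ψ) (neg χ))) (B (imp χ ψ))) :=
    trans (K_imp_B hT _) (B_mono_taut hd fun v => by simp only [peval_imp, peval_neg]; tauto)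
  have h₂ : Derivable Ax Ru (imp (B ψ) (B (imp χ ψ))) :=
    B_mono_taut hd fun v => by simp only [peval_imp]; tauto
  refine conseq₃ h h₁ h₂ fun v => ?_
  simp only [chain, peval_imp, peval_neg]
  tauto

end Derivable

end Calculus

/-! ### Every S5 theorem is believed -/

section BelievedFromS5

open Derivable

variable {Var Pred : Type u} {ar : Pred → ℕ} [DecidableEq Var]

theorem axDist_subset_S42 (o : WhOp) :
    (axDist : Set (Form Var Pred ar)) ⊆ axS42 ∪ whAxioms o :=
  fun _ h => Or.inl (Or.inl (Or.inl (Or.inl h)))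

theorem axT_subset_S42 (o : WhOp) : (axT : Set (Form Var Pred ar)) ⊆ axS42 ∪ whAxioms o :=
  fun _ h => Or.inl (Or.inl (Or.inl (Or.inr h)))

theorem axFour_subset_S42 (o : WhOp) : (axFour : Set (Form Var Pred ar)) ⊆ axS42 ∪ whAxioms o :=
  fun _ h => Or.inl (Or.inl (Or.inr h))

theorem axDotTwo_subset_S42 (o : WhOp) :
    (axDotTwo : Set (Form Var Pred ar)) ⊆ axS42 ∪ whAxioms o :=
  fun _ h => Or.inl (Or.inr h)

/-- For the two operators without false-belief sensitivity the implication is itself a theorem,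
hence believed. For the other two, knowing an instance need not give `[K_wh]`, but the axiom
`BtoBKwh` gives belief in it, and `B_K_imp` turns this into a believed implication. -/
theorem B_KtoKwh (o : WhOp) {x y : Var} {φ : Form Var Pred ar} (hxy : Admissible x y φ) :
    Derivable (axS42 ∪ whAxioms o) (whRules o) (B (imp (K (subst x y φ)) (wh x φ))) := by
  have hd := axDist_subset_S42 (Pred := Pred) (ar := ar) (Var := Var) o
  have hT := axT_subset_S42 (Pred := Pred) (ar := ar) (Var := Var) o
  cases o with
  | tBMS =>
    have h₁ : Derivable (axS42 ∪ whAxioms .tBMS) (whRules .tBMS)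
        (imp (and (B (subst x y φ)) (subst x y φ)) (wh x φ)) :=
      ax (Or.inr ⟨x, y, φ, hxy, rfl⟩)
    have h₂ : Derivable (axS42 ∪ whAxioms .tBMS) (whRules .tBMS)
        (imp (K (subst x y φ)) (subst x y φ)) := ax (hT ⟨_, rfl⟩)
    refine believe hT (conseq₃ h₁ h₂ (K_imp_B hT (subst x y φ)) fun v => ?_)
    simp only [peval_imp, peval_and]
    tauto
  | tBMSFS => exact B_K_imp hd hT (ax (Or.inr (Or.inr ⟨x, y, φ, hxy, rfl⟩)))
  | KMS => exact believe hT (ax (Or.inr ⟨x, y, φ, hxy, rfl⟩))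
  | KMSFS => exact B_K_imp hd hT (ax (Or.inr (Or.inr ⟨x, y, φ, hxy, rfl⟩)))

/-- The believed implication is converted into a chain ending in `neg (K φ)` or `neg (and (B φ) φ)`,
as the operator's rule requires; both negated formulas imply `B φ`. The chain's antecedents contain
only variables of ψ, so the rule applies, and the result is converted back. -/
theorem B_KwhtoKZero (o : WhOp) {x : Var} {φ ψ : Form Var Pred ar} (hx : x ∉ fv ψ)
    (h : Derivable (axS42 ∪ whAxioms o) (whRules o) (B (imp (K φ) ψ))) :
    Derivable (axS42 ∪ whAxioms o) (whRules o) (B (imp (wh x φ) ψ)) := by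
  have hd := axDist_subset_S42 (Pred := Pred) (ar := ar) (Var := Var) o
  have hT := axT_subset_S42 (Pred := Pred) (ar := ar) (Var := Var) o
  have h4 := axFour_subset_S42 (Pred := Pred) (ar := ar) (Var := Var) o
  have h2 := axDotTwo_subset_S42 (Pred := Pred) (ar := ar) (Var := Var) o
  have hfv : ∀ θ ∈ [neg (B ψ), imp ψ ψ], x ∉ fv θ := by
    simp [B, dia, imp, fv, hx]
  have hK := chain_neg_B hd h4 h2 h (K_imp_B hT φ)
  have hB := chain_neg_B (χ := and (B φ) φ) hd h4 h2 h
    (taut fun v => by simp only [peval_imp, peval_and]; tauto)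
  refine B_imp_of_chain hd hT ?_
  cases o with
  | tBMS => exact rule ⟨_, _, x, φ, hfv, rfl, rfl⟩ hB
  | tBMSFS => exact rule (Or.inl ⟨_, _, x, φ, hfv, rfl, rfl⟩) hB
  | KMS => exact rule ⟨_, _, x, φ, hfv, rfl, rfl⟩ hK
  | KMSFS => exact rule (Or.inl ⟨_, _, x, φ, hfv, rfl, rfl⟩) hK

theorem S5Wh_subset_believed (o : WhOp) :
    S5Wh Var Pred ar ⊆ believed (S42Wh Var Pred ar o) := by
  have hd := axDist_subset_S42 (Pred := Pred) (ar := ar) (Var := Var) o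
  have hT := axT_subset_S42 (Pred := Pred) (ar := ar) (Var := Var) o
  have h4 := axFour_subset_S42 (Pred := Pred) (ar := ar) (Var := Var) o
  have h2 := axDotTwo_subset_S42 (Pred := Pred) (ar := ar) (Var := Var) o
  intro φ h
  change Derivable (axS42 ∪ whAxioms o) (whRules o) (B φ)
  induction h with
  | taut t => exact believe hT (taut t)
  | ax h =>
    rcases h with (((h | h) | h) | ⟨φ, rfl⟩) | ⟨x, y, φ, hxy, rfl⟩
    · exact believe hT (ax (hd h))
    · exact believe hT (ax (hT h))
    · exact believe hT (ax (h4 h))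
    · exact B_five hd hT h4 φ
    · exact B_KtoKwh o hxy
  | mp _ _ ih₁ ih₂ => exact mp (mp (B_dist hd h4 h2 _ _) ih₁) ih₂
  | nec _ ih => exact mp (B_imp_BK hd h4 _) ih
  | rule r _ ih =>
    obtain ⟨x, φ, ψ, hx, rfl, rfl⟩ := r
    exact B_KwhtoKZero o hx ih

end BelievedFromS5

/-! ### Soundness on equivalence relations under the mention-some reading -/

section Soundness

variable {Var Pred : Type u} {ar : Pred → ℕ} [DecidableEq Var]

theorem subst_of_notMem_fv {x y : Var} {φ : Form Var Pred ar} (hx : x ∉ fv φ) :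
    subst x y φ = φ := by
  induction φ with
  | atom p ys =>
    simp only [fv, Set.mem_range, not_exists] at hx
    simp [subst, hx]
  | neg φ ih => simp only [subst, ih hx]
  | and φ ψ ih₁ ih₂ =>
    simp only [fv, Set.mem_union, not_or] at hx
    simp only [subst, ih₁ hx.1, ih₂ hx.2]
  | K φ ih => simp only [subst, ih hx]
  | wh z φ ih =>
    by_cases hz : z = x
    · simp [subst, hz]
    · have : x ∉ fv φ := fun h => hx ⟨h, fun h' => hz h'.symm⟩
      simp [subst, hz, ih this]

/-- Truth depends only on the values of the free variables. -/
theorem Model.sat_congr (M : Model Pred ar) (o : WhOp) {φ : Form Var Pred ar} {w : M.W}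
    {σ τ : Var → M.D} (h : ∀ z ∈ fv φ, σ z = τ z) : M.Sat o φ w σ ↔ M.Sat o φ w τ := by
  induction φ generalizing w σ τ with
  | atom p ys =>
    have : (fun i => σ (ys i)) = fun i => τ (ys i) := funext fun i => h _ ⟨i, rfl⟩
    simp only [Sat, this]
  | neg φ ih => simp only [Sat, ih h]
  | and φ ψ ih₁ ih₂ =>
    simp only [Sat, ih₁ fun z hz => h z (Or.inl hz), ih₂ fun z hz => h z (Or.inr hz)]
  | K φ ih =>
    have : ∀ v, M.Sat o φ v σ ↔ M.Sat o φ v τ := fun v => ih h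
    simp only [Sat, this]
  | wh x φ ih =>
    have : ∀ a v, M.Sat o φ v (Function.update σ x a) ↔ M.Sat o φ v (Function.update τ x a) := by
      refine fun a v => ih fun z hz => ?_
      by_cases hzx : z = x
      · simp [hzx]
      · simpa [hzx] using h z ⟨hz, hzx⟩
    simp only [Sat, this]

theorem Model.sat_update_of_notMem_fv (M : Model Pred ar) (o : WhOp) {φ : Form Var Pred ar}
    {x : Var} (hx : x ∉ fv φ) (w : M.W) (σ : Var → M.D) (a : M.D) :
    M.Sat o φ w (Function.update σ x a) ↔ M.Sat o φ w σ :=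
  M.sat_congr o fun z hz => Function.update_of_ne (fun h => hx (by rwa [h] at hz)) _ _

theorem Model.sat_subst (M : Model Pred ar) (o : WhOp) {x y : Var} {φ : Form Var Pred ar}
    (h : Admissible x y φ) (w : M.W) (σ : Var → M.D) :
    M.Sat o (subst x y φ) w σ ↔ M.Sat o φ w (Function.update σ x (σ y)) := by
  induction φ generalizing w σ with
  | atom p ys =>
    have : (fun i => σ (if ys i = x then y else ys i)) =
        fun i => Function.update σ x (σ y) (ys i) := by
      funext i
      by_cases hi : ys i = x <;> simp [hi]
    simp only [subst, Sat, this]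
  | neg φ ih => simp only [subst, Sat, ih h]
  | and φ ψ ih₁ ih₂ => simp only [subst, Sat, ih₁ h.1, ih₂ h.2]
  | K φ ih => simp only [subst, Sat, ih h]
  | wh z φ ih =>
    by_cases hx : x ∈ fv (wh z φ)
    · have hzx : z ≠ x := fun e => hx.2 e.symm
      obtain ⟨hzy, had⟩ := h.resolve_left (not_not.2 hx)
      have : ∀ a v, M.Sat o (subst x y φ) v (Function.update σ z a) ↔
          M.Sat o φ v (Function.update (Function.update σ x (σ y)) z a) := by
        intro a v
        rw [ih had, Function.update_of_ne hzy.symm, Function.update_comm hzx.symm]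
      simp only [subst, hzx, if_false, Sat, this]
    · rw [subst_of_notMem_fv hx, M.sat_update_of_notMem_fv o hx]

@[simp]
theorem Model.sat_imp (M : Model Pred ar) (o : WhOp) (φ ψ : Form Var Pred ar) (w : M.W)
    (σ : Var → M.D) : M.Sat o (imp φ ψ) w σ ↔ (M.Sat o φ w σ → M.Sat o ψ w σ) := by
  simp [imp, Sat]

theorem Model.sat_iff_peval (M : Model Pred ar) (o : WhOp) (φ : Form Var Pred ar) (w : M.W)
    (σ : Var → M.D) : M.Sat o φ w σ ↔ peval (fun χ => M.Sat o χ w σ) φ := by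
  induction φ with
  | neg φ ih => simp only [Sat, peval, ih]
  | and φ ψ ih₁ ih₂ => simp only [Sat, peval, ih₁, ih₂]
  | _ => rfl

/-- On equivalence relations belief is knowledge. -/
theorem bHolds_iff {W : Type u} {R : W → W → Prop} (hR : Equivalence R) (w : W) (S : W → Prop) :
    BHolds R w S ↔ KHolds R w S :=
  ⟨fun ⟨_, hv, h⟩ u hu => h u (hR.trans (hR.symm hv) hu), fun h => ⟨w, hR.refl w, h⟩⟩

theorem Model.sat_B (M : Model Pred ar) (hR : Equivalence M.R) (o : WhOp) (φ : Form Var Pred ar)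
    (w : M.W) (σ : Var → M.D) :
    M.Sat o (B φ) w σ ↔ KHolds M.R w (fun v => M.Sat o φ v σ) := by
  rw [← bHolds_iff hR]
  simp [B, dia, Sat, KHolds, BHolds]

/-- No antecedent depends on the value of `x`, and the domain is constant, so "for all values of
`x`" moves inward through the implications and the `[K]`s. The soundness of every chain rule thus
reduces to an entailment between the final formulas. -/
theorem Model.sat_chain (M : Model Pred ar) (o : WhOp) {x : Var} {χ χ' : Form Var Pred ar}
    {σ : Var → M.D}
    (hχ : ∀ w, (∀ a, M.Sat o χ w (Function.update σ x a)) → M.Sat o χ' w σ)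
    {l : List (Form Var Pred ar)} {ψ : Form Var Pred ar} (hx : ∀ θ ∈ ψ :: l, x ∉ fv θ) {w : M.W}
    (h : ∀ a, M.Sat o (chain ψ l χ) w (Function.update σ x a)) :
    M.Sat o (chain ψ l χ') w σ := by
  have hψ : ∀ a w, M.Sat o ψ w (Function.update σ x a) ↔ M.Sat o ψ w σ :=
    fun a w => M.sat_update_of_notMem_fv o (hx ψ (by simp)) w σ a
  induction l generalizing ψ w with
  | nil =>
    simp only [chain, sat_imp, hψ] at h ⊢
    exact fun h' => hχ w fun a => h a h'
  | cons ψ' l ih =>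
    simp only [chain, sat_imp, hψ] at h ⊢
    intro h' v hv
    exact ih (fun θ hθ => hx θ (List.mem_cons_of_mem _ hθ)) (fun a => h a h' v hv)
      fun a w => M.sat_update_of_notMem_fv o (hx ψ' (by simp)) w σ a

/-- `[K]φ[y/x]` implies `[K_wh]^x φ` under the mention-some reading. -/
theorem Model.sat_wh_of_subst (M : Model Pred ar) {x y : Var} {φ : Form Var Pred ar}
    (hxy : Admissible x y φ) {w : M.W} {σ : Var → M.D}
    (h : KHolds M.R w (fun v => M.Sat .KMS (subst x y φ) v σ)) : M.Sat .KMS (wh x φ) w σ :=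
  ⟨σ y, fun v hv => (M.sat_subst .KMS hxy v σ).1 (h v hv)⟩

theorem Model.sat_of_axS42 (M : Model Pred ar) (hR : Equivalence M.R) {χ : Form Var Pred ar}
    (h : χ ∈ axS42) (w : M.W) (σ : Var → M.D) : M.Sat .KMS χ w σ := by
  rcases h with ((⟨φ, ψ, rfl⟩ | ⟨φ, rfl⟩) | ⟨φ, rfl⟩) | ⟨φ, rfl⟩
  · simp only [sat_imp, Sat]
    exact fun h₁ h₂ v hv => h₁ v hv (h₂ v hv)
  · simp only [sat_imp, Sat]
    exact fun h => h w (hR.refl w)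
  · simp only [sat_imp, Sat]
    exact fun h v hv u hu => h u (hR.trans hv hu)
  · rw [sat_imp]
    intro h v hv hn
    rw [← B, M.sat_B hR] at h
    exact hn v (hR.refl v) (h v hv)

theorem Model.sat_of_whAxioms (M : Model Pred ar) (hR : Equivalence M.R) {o : WhOp}
    {χ : Form Var Pred ar} (h : χ ∈ whAxioms o) (w : M.W) (σ : Var → M.D) :
    M.Sat .KMS χ w σ := by
  have fs : ∀ χ : Form Var Pred ar, χ ∈ KwhtoFS ∪ BtoBKwh → M.Sat .KMS χ w σ := by
    rintro _ (⟨x, y, φ, hxy, rfl⟩ | ⟨x, y, φ, hxy, rfl⟩)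
    -- The consequent holds outright: belief is knowledge here, hence factive.
    · change M.Sat .KMS (imp (wh x φ) (imp (B (subst x y φ)) (subst x y φ))) w σ
      rw [sat_imp, sat_imp, M.sat_B hR]
      exact fun _ h => h w (hR.refl w)
    · rw [sat_imp, M.sat_B hR, M.sat_B hR]
      exact fun h v hv => M.sat_wh_of_subst hxy fun u hu => h u (hR.trans hv hu)
  cases o with
  | tBMS =>
    obtain ⟨x, y, φ, hxy, rfl⟩ := h
    change M.Sat .KMS (imp (and (B (subst x y φ)) (subst x y φ)) (wh x φ)) w σ
    rw [sat_imp]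
    exact fun h => M.sat_wh_of_subst hxy ((M.sat_B hR _ _ _ _).1 h.1)
  | tBMSFS => exact fs χ h
  | KMS =>
    obtain ⟨x, y, φ, hxy, rfl⟩ := h
    rw [sat_imp]
    exact fun h => M.sat_wh_of_subst hxy h
  | KMSFS => exact fs χ h

theorem Model.sat_of_whRules (M : Model Pred ar) (hR : Equivalence M.R) {o : WhOp}
    {α β : Form Var Pred ar} (r : whRules o α β) (h : ∀ w σ, M.Sat .KMS α w σ) (w : M.W)
    (σ : Var → M.D) : M.Sat .KMS β w σ := by
  have tb : KwhtoTB α β → M.Sat .KMS β w σ := by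
    rintro ⟨ψ, l, x, φ, hx, rfl, rfl⟩
    refine M.sat_chain .KMS (fun v hv => ?_) hx fun a => h w _
    rintro ⟨a, ha⟩
    exact hv a ⟨(M.sat_B hR _ _ _ _).2 ha, ha v (hR.refl v)⟩
  have k : KwhtoK α β → M.Sat .KMS β w σ := by
    rintro ⟨ψ, l, x, φ, hx, rfl, rfl⟩
    refine M.sat_chain .KMS (fun v hv => ?_) hx fun a => h w _
    rintro ⟨a, ha⟩
    exact hv a ha
  cases o with
  | tBMS => exact tb r
  | tBMSFS =>
    rcases r with r | ⟨ψ, l, x, y, φ, hx, hxy, rfl, rfl⟩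
    · exact tb r
    -- The final formula is valid by itself, since belief in an instance is knowledge of it.
    · refine M.sat_chain .KMS (fun v _ => ?_) hx fun a => h w _
      rw [sat_imp, M.sat_B hR]
      exact fun h => M.sat_wh_of_subst hxy h
  | KMS => exact k r
  | KMSFS =>
    rcases r with r | ⟨ψ, l, x, y, φ, hx, hxy, rfl, rfl⟩
    · exact k r
    · refine M.sat_chain .KMS (fun v _ => ?_) hx fun a => h w _
      rw [sat_imp]
      exact fun h => M.sat_wh_of_subst hxy h

/-- On equivalence relations, each of the four logics is sound for the mention-some reading. -/
theorem validS5_of_mem_S42Wh {o : WhOp} {φ : Form Var Pred ar} (h : φ ∈ S42Wh Var Pred ar o) :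
    ValidS5 .KMS φ := by
  intro M hR
  induction h with
  | taut t => exact fun w σ => (M.sat_iff_peval _ _ _ _).2 (t _)
  | ax h =>
    rcases h with h | h
    · exact M.sat_of_axS42 hR h
    · exact M.sat_of_whAxioms hR h
  | mp _ _ ih₁ ih₂ => exact fun w σ => (M.sat_imp _ _ _ _ _).1 (ih₁ w σ) (ih₂ w σ)
  | nec _ ih => exact fun w σ v _ => ih v σ
  | rule r _ ih => exact M.sat_of_whRules hR r ih

theorem believed_subset_validS5 (o : WhOp) :
    believed (S42Wh Var Pred ar o) ⊆ {φ | ValidS5 .KMS φ} :=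
  fun _ h M hR w σ =>
    (M.sat_B hR _ _ _ _).1 (validS5_of_mem_S42Wh h M hR w σ) w (hR.refl w)

end Soundness

/-! ### Variables, simultaneous renaming and countability -/

section Renaming

variable {Var Pred : Type u} {ar : Pred → ℕ}

/-- Bound variables. -/
def bv : Form Var Pred ar → Set Var
  | .atom _ _ => ∅
  | .neg φ => bv φ
  | .and φ ψ => bv φ ∪ bv ψ
  | .K φ => bv φ
  | .wh x φ => insert x (bv φ)

theorem finite_fv (φ : Form Var Pred ar) : (fv φ).Finite := by
  induction φ with
  | atom p ys => exact Set.finite_range ys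
  | neg φ ih => exact ih
  | and φ ψ ih₁ ih₂ => exact ih₁.union ih₂
  | K φ ih => exact ih
  | wh x φ ih => exact ih.sdiff

theorem finite_bv (φ : Form Var Pred ar) : (bv φ).Finite := by
  induction φ with
  | atom p ys => exact Set.finite_empty
  | neg φ ih => exact ih
  | and φ ψ ih₁ ih₂ => exact ih₁.union ih₂
  | K φ ih => exact ih
  | wh x φ ih => exact ih.insert x

theorem admissible_of_notMem_bv {x y : Var} {φ : Form Var Pred ar} (hy : y ∉ bv φ) :
    Admissible x y φ := by
  induction φ with
  | atom p ys => trivial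
  | neg φ ih => exact ih hy
  | and φ ψ ih₁ ih₂ => exact ⟨ih₁ fun h => hy (Or.inl h), ih₂ fun h => hy (Or.inr h)⟩
  | K φ ih => exact ih hy
  | wh z φ ih => exact Or.inr ⟨fun h => hy (Or.inl h.symm), ih fun h => hy (Or.inr h)⟩

/-- The subformulas `[K_wh]^x θ`, as pairs `(x, θ)`. -/
def whSub : Form Var Pred ar → Set (Var × Form Var Pred ar)
  | .atom _ _ => ∅
  | .neg φ => whSub φ
  | .and φ ψ => whSub φ ∪ whSub ψ
  | .K φ => whSub φ
  | .wh x φ => insert (x, φ) (whSub φ)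

theorem finite_whSub (φ : Form Var Pred ar) : (whSub φ).Finite := by
  induction φ with
  | atom p ys => exact Set.finite_empty
  | neg φ ih => exact ih
  | and φ ψ ih₁ ih₂ => exact ih₁.union ih₂
  | K φ ih => exact ih
  | wh x φ ih => exact ih.insert _

theorem bv_subset_of_mem_whSub {φ : Form Var Pred ar} {p : Var × Form Var Pred ar}
    (hp : p ∈ whSub φ) : insert p.1 (bv p.2) ⊆ bv φ := by
  induction φ with
  | atom _ ys => exact hp.elim
  | neg φ ih => exact ih hp
  | and φ ψ ih₁ ih₂ =>
    rcases hp with hp | hp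
    · exact (ih₁ hp).trans Set.subset_union_left
    · exact (ih₂ hp).trans Set.subset_union_right
  | K φ ih => exact ih hp
  | wh x φ ih =>
    rcases hp with rfl | hp
    · exact subset_rfl
    · exact (ih hp).trans (Set.subset_insert _ _)

variable [DecidableEq Var]

/-- Simultaneous replacement of the free variables along `σ`, without renaming bound variables. -/
def rename : (Var → Var) → Form Var Pred ar → Form Var Pred ar
  | σ, .atom p ys => atom p fun i => σ (ys i)
  | σ, .neg φ => neg (rename σ φ)
  | σ, .and φ ψ => .and (rename σ φ) (rename σ ψ)
  | σ, .K φ => K (rename σ φ)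
  | σ, .wh x φ => wh x (rename (Function.update σ x x) φ)

theorem rename_congr {σ τ : Var → Var} {φ : Form Var Pred ar} (h : ∀ z ∈ fv φ, σ z = τ z) :
    rename σ φ = rename τ φ := by
  induction φ generalizing σ τ with
  | atom p ys =>
    have : (fun i => σ (ys i)) = fun i => τ (ys i) := funext fun i => h _ ⟨i, rfl⟩
    simp only [rename, this]
  | neg φ ih => simp only [rename, ih h]
  | and φ ψ ih₁ ih₂ =>
    simp only [rename, ih₁ fun z hz => h z (Or.inl hz), ih₂ fun z hz => h z (Or.inr hz)]
  | K φ ih => simp only [rename, ih h]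
  | wh x φ ih =>
    have : rename (Function.update σ x x) φ = rename (Function.update τ x x) φ := by
      refine ih fun z hz => ?_
      by_cases hzx : z = x
      · simp [hzx]
      · simpa [hzx] using h z ⟨hz, hzx⟩
    simp only [rename, this]

theorem rename_id (φ : Form Var Pred ar) : rename id φ = φ := by
  induction φ with
  | atom p ys => rfl
  | neg φ ih => simp only [rename, ih]
  | and φ ψ ih₁ ih₂ => simp only [rename, ih₁, ih₂]
  | K φ ih => simp only [rename, ih]
  | wh x φ ih =>
    have : Function.update id x x = (id : Var → Var) := Function.update_eq_self x id
    simp only [rename, this, ih]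

theorem subst_eq_rename (x y : Var) (φ : Form Var Pred ar) :
    subst x y φ = rename (Function.update id x y) φ := by
  induction φ with
  | atom p ys => simp only [subst, rename, Function.update_apply, id]
  | neg φ ih => simp only [subst, rename, ih]
  | and φ ψ ih₁ ih₂ => simp only [subst, rename, ih₁, ih₂]
  | K φ ih => simp only [subst, rename, ih]
  | wh z φ ih =>
    by_cases hz : z = x
    · subst hz
      have : Function.update id z z = (id : Var → Var) := Function.update_eq_self z id
      simp [Form.subst, rename, this, rename_id]
    · have : Function.update (Function.update id x y) z z = Function.update id x y := by
        rw [Function.update_eq_self_iff, Function.update_of_ne hz, id]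
      simp [Form.subst, rename, hz, this, ih]

theorem bv_rename (σ : Var → Var) (φ : Form Var Pred ar) : bv (rename σ φ) = bv φ := by
  induction φ generalizing σ with
  | atom p ys => rfl
  | neg φ ih => simp only [rename, bv, ih]
  | and φ ψ ih₁ ih₂ => simp only [rename, bv, ih₁, ih₂]
  | K φ ih => simp only [rename, bv, ih]
  | wh x φ ih => simp only [rename, bv, ih]

theorem fv_rename_subset (σ : Var → Var) (φ : Form Var Pred ar) :
    fv (rename σ φ) ⊆ σ '' fv φ := by
  induction φ generalizing σ with
  | atom p ys =>
    rintro _ ⟨i, rfl⟩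
    exact ⟨_, ⟨i, rfl⟩, rfl⟩
  | neg φ ih => exact ih σ
  | and φ ψ ih₁ ih₂ =>
    simp only [rename, fv, Set.image_union]
    exact Set.union_subset_union (ih₁ σ) (ih₂ σ)
  | K φ ih => exact ih σ
  | wh x φ ih =>
    rintro z ⟨hz, hzx⟩
    obtain ⟨t, ht, rfl⟩ := ih _ hz
    by_cases htx : t = x
    · simp [htx] at hzx
    · exact ⟨t, ⟨ht, htx⟩, by simp [htx]⟩

/-- Renamings compose as long as the first one moves no variable to a bound one that the second
one moves. -/
theorem rename_rename {σ τ : Var → Var} {φ : Form Var Pred ar}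
    (h : ∀ z ∈ fv φ, σ z ∈ bv φ → τ (σ z) = σ z ∨ σ z = z) :
    rename τ (rename σ φ) = rename (τ ∘ σ) φ := by
  induction φ generalizing σ τ with
  | atom p ys => rfl
  | neg φ ih => simp only [rename, ih h]
  | and φ ψ ih₁ ih₂ =>
    simp only [rename, ih₁ fun z hz hb => h z (Or.inl hz) (Or.inl hb),
      ih₂ fun z hz hb => h z (Or.inr hz) (Or.inr hb)]
  | K φ ih => simp only [rename, ih h]
  | wh x φ ih =>
    simp only [rename]
    rw [ih]
    · congr 1
      refine rename_congr fun z hz => ?_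
      by_cases hzx : z = x
      · simp [hzx]
      · by_cases hσ : σ z = x
        · rcases h z ⟨hz, hzx⟩ (Or.inl hσ) with h' | h'
          · rw [hσ] at h'
            simp [hzx, hσ, h']
          · exact absurd (h'.symm.trans hσ) hzx
        · simp [hzx, hσ]
    · intro z hz hb
      by_cases hzx : z = x
      · simp [hzx]
      · simp only [Function.update_of_ne hzx] at hb ⊢
        rcases h z ⟨hz, hzx⟩ (Or.inr hb) with h' | h'
        · by_cases hσ : σ z = x
          · simp [hσ]
          · simp [hσ, h']
        · exact Or.inr h'

theorem subst_subst_cancel {x y : Var} {φ : Form Var Pred ar} (hy : y ∉ fv φ) (hb : y ∉ bv φ) :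
    subst y x (subst x y φ) = φ := by
  have hne : ∀ z ∈ fv φ, z ≠ y := fun z hz h => hy (h ▸ hz)
  rw [subst_eq_rename, subst_eq_rename, rename_rename]
  · conv_rhs => rw [← rename_id φ]
    refine rename_congr fun z hz => ?_
    by_cases hzx : z = x
    · simp [hzx]
    · simp [hzx, hne z hz]
  · intro z hz h
    by_cases hzx : z = x
    · simp [hzx, hb] at h
    · simp [hzx]

theorem notMem_fv_subst {x y : Var} (hxy : x ≠ y) (φ : Form Var Pred ar) :
    x ∉ fv (subst x y φ) := by
  rw [subst_eq_rename]
  intro h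
  obtain ⟨z, _, hz⟩ := fv_rename_subset _ _ h
  by_cases hzx : z = x
  · exact hxy (by simpa [hzx] using hz.symm)
  · simp [hzx] at hz

/-- The occurrences of `y` in `subst x y φ` are the replaced ones, and nothing was replaced under a
binder of `x`, so putting `x` back cannot lead to capture. -/
theorem admissible_subst_cancel {x y : Var} {φ : Form Var Pred ar} (hy : y ∉ fv φ)
    (hb : y ∉ bv φ) : Admissible y x (subst x y φ) := by
  induction φ with
  | atom p ys => trivial
  | neg φ ih => exact ih hy hb
  | and φ ψ ih₁ ih₂ =>
    exact ⟨ih₁ (fun h => hy (Or.inl h)) fun h => hb (Or.inl h),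
      ih₂ (fun h => hy (Or.inr h)) fun h => hb (Or.inr h)⟩
  | K φ ih => exact ih hy hb
  | wh z φ ih =>
    by_cases hz : z = x
    · simp only [subst, hz, if_true]
      exact Or.inl (by rwa [hz] at hy)
    · simp only [subst, hz, if_false]
      exact Or.inr ⟨hz, ih (fun h => hy ⟨h, fun e => hb (Or.inl e)⟩) fun h => hb (Or.inr h)⟩

/-- Renaming into a countable set of variables yields countably many formulas. -/
theorem countable_rename {V : Set Var} (hV : V.Countable) (φ : Form Var Pred ar)
    (hφ : bv φ ⊆ V) : {χ | ∃ σ : Var → Var, (∀ z, σ z ∈ V) ∧ χ = rename σ φ}.Countable := by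
  have := hV.to_subtype
  induction φ with
  | atom p ys =>
    refine (Set.countable_range fun f : Fin (ar p) → V =>
      (atom p fun i => (f i : Var) : Form Var Pred ar)).mono ?_
    rintro _ ⟨σ, hσ, rfl⟩
    exact ⟨fun i => ⟨σ (ys i), hσ _⟩, rfl⟩
  | neg φ ih =>
    refine ((ih hφ).image neg).mono ?_
    rintro _ ⟨σ, hσ, rfl⟩
    exact ⟨_, ⟨σ, hσ, rfl⟩, rfl⟩
  | and φ ψ ih₁ ih₂ =>
    refine ((ih₁ fun z h => hφ (Or.inl h)).image2 (ih₂ fun z h => hφ (Or.inr h)) and).mono ?_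
    rintro _ ⟨σ, hσ, rfl⟩
    exact ⟨_, ⟨σ, hσ, rfl⟩, _, ⟨σ, hσ, rfl⟩, rfl⟩
  | K φ ih =>
    refine ((ih hφ).image K).mono ?_
    rintro _ ⟨σ, hσ, rfl⟩
    exact ⟨_, ⟨σ, hσ, rfl⟩, rfl⟩
  | wh x φ ih =>
    refine ((ih fun z h => hφ (Or.inr h)).image (wh x)).mono ?_
    rintro _ ⟨σ, hσ, rfl⟩
    -- The updated map sends `x` to itself, which is why `V` must contain the bound variables.
    refine ⟨_, ⟨Function.update σ x x, fun z => ?_, rfl⟩, rfl⟩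
    by_cases hz : z = x
    · simpa [hz] using hφ (Or.inl rfl)
    · simpa [hz] using hσ z

end Renaming

/-! ### Completeness of the S5 system -/

section S5

open Derivable

variable {Var Pred : Type u} {ar : Pred → ℕ} [DecidableEq Var]

/-- Theoremhood in `S5Wh`. -/
abbrev Thm (φ : Form Var Pred ar) : Prop := Derivable (axS5 ∪ KtoKwh) KwhtoKZero φ

theorem axDist_subset_S5 : (axDist : Set (Form Var Pred ar)) ⊆ axS5 ∪ KtoKwh :=
  fun _ h => Or.inl (Or.inl (Or.inl (Or.inl h)))

theorem Thm.axT (φ : Form Var Pred ar) : Thm (imp (K φ) φ) :=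
  ax (Or.inl (Or.inl (Or.inl (Or.inr ⟨φ, rfl⟩))))

theorem Thm.axFour (φ : Form Var Pred ar) : Thm (imp (K φ) (K (K φ))) :=
  ax (Or.inl (Or.inl (Or.inr ⟨φ, rfl⟩)))

theorem Thm.axFive (φ : Form Var Pred ar) : Thm (imp (neg (K φ)) (K (neg (K φ)))) :=
  ax (Or.inl (Or.inr ⟨φ, rfl⟩))

theorem Thm.wh_intro {x y : Var} {φ : Form Var Pred ar} (h : Admissible x y φ) :
    Thm (imp (K (subst x y φ)) (wh x φ)) := ax (Or.inr ⟨x, y, φ, h, rfl⟩)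

theorem Thm.wh_elim {x : Var} {φ ψ : Form Var Pred ar} (hx : x ∉ fv ψ)
    (h : Thm (imp (K φ) ψ)) : Thm (imp (wh x φ) ψ) := rule ⟨x, φ, ψ, hx, rfl, rfl⟩ h

theorem subst_self (x : Var) (φ : Form Var Pred ar) : subst x x φ = φ := by
  have : Function.update id x x = (id : Var → Var) := Function.update_eq_self x id
  rw [subst_eq_rename, this, rename_id]

theorem admissible_self (x : Var) (φ : Form Var Pred ar) : Admissible x x φ := by
  induction φ with
  | atom p ys => trivial
  | neg φ ih => exact ih
  | and φ ψ ih₁ ih₂ => exact ⟨ih₁, ih₂⟩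
  | K φ ih => exact ih
  | wh z φ ih =>
    by_cases hz : z = x
    · exact Or.inl fun h => h.2 hz.symm
    · exact Or.inr ⟨hz, ih⟩

/-- Knowledge-wh is known. -/
theorem Thm.wh_imp_K (x : Var) (φ : Form Var Pred ar) : Thm (imp (wh x φ) (K (wh x φ))) := by
  have h : Thm (imp (K φ) (wh x φ)) := by
    simpa only [subst_self] using Thm.wh_intro (admissible_self x φ)
  exact wh_elim (fun h => h.2 rfl) (trans (axFour φ) (K_mono axDist_subset_S5 h))

/-- Renaming the bound variable of a `wh` formula. -/
theorem Thm.wh_rename {x y : Var} {φ : Form Var Pred ar} (hy : y ∉ fv φ) (hb : y ∉ bv φ) :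
    Thm (imp (wh x φ) (wh y (subst x y φ))) := by
  have h : Thm (imp (K φ) (wh y (subst x y φ))) := by
    simpa only [subst_subst_cancel hy hb] using Thm.wh_intro (admissible_subst_cancel hy hb)
  refine wh_elim (fun hx => ?_) h
  have hxy : x ≠ y := hx.2
  exact notMem_fv_subst hxy φ hx.1

/-- Theorems are closed under admissible substitution. -/
theorem Thm.subst {x y : Var} {φ : Form Var Pred ar} (hxy : Admissible x y φ) (h : Thm φ) :
    Thm (subst x y φ) := by
  by_cases hx : x ∈ fv φ
  swap
  · rwa [subst_of_notMem_fv hx]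
  -- A falsum without free `x`. As φ is a theorem, `K (neg (K φ))` is refutable, so by the
  -- elimination rule `wh x (neg (K φ))` is too. By the introduction axiom so is `K (neg (K
  -- φ[y/x]))`, whence negative introspection yields `K φ[y/x]`.
  let ψ : Form Var Pred ar := neg (imp (wh x φ) (wh x φ))
  have hψ : x ∉ fv ψ := by simp [ψ, imp, fv]
  have h₁ : Thm (imp (K (neg (K φ))) ψ) :=
    conseq₂ (nec h) (Thm.axT (neg (K φ))) fun v => by
      simp only [peval_imp, peval_neg]; tauto
  have h₂ := wh_elim hψ h₁
  have h₃ : Thm (imp (K (neg (K (Form.subst x y φ)))) (wh x (neg (K φ)))) :=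
    Thm.wh_intro (φ := neg (K φ)) hxy
  have h₄ : Thm (K (Form.subst x y φ)) :=
    conseq₃ h₂ h₃ (Thm.axFive (Form.subst x y φ)) fun v => by
      simp only [ψ, peval_imp, peval_neg]; tauto
  exact mp (Thm.axT _) h₄

/-- A set of formulas that contains the theorems and is closed under modus ponens. -/
structure IsTheory (T : Set (Form Var Pred ar)) : Prop where
  thm_mem : ∀ {φ}, Thm φ → φ ∈ T
  mp_mem : ∀ {φ ψ}, imp φ ψ ∈ T → φ ∈ T → ψ ∈ T

/-- Maximal consistent sets. -/
structure IsMaxCons (T : Set (Form Var Pred ar)) : Prop extends IsTheory T where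
  neg_mem : ∀ {φ}, neg φ ∈ T ↔ φ ∉ T

theorem IsTheory.conseq {T : Set (Form Var Pred ar)} (hT : IsTheory T) {α φ : Form Var Pred ar}
    (h : α ∈ T) (t : ∀ v, peval v α → peval v φ) : φ ∈ T :=
  hT.mp_mem (hT.thm_mem (taut fun v => (peval_imp v α φ).2 (t v))) h

theorem IsTheory.conseq₂ {T : Set (Form Var Pred ar)} (hT : IsTheory T)
    {α β φ : Form Var Pred ar} (h₁ : α ∈ T) (h₂ : β ∈ T)
    (t : ∀ v, peval v α → peval v β → peval v φ) : φ ∈ T :=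
  hT.mp_mem (hT.conseq h₁ fun v h => (peval_imp v β φ).2 (t v h)) h₂

theorem IsTheory.adjoin {T : Set (Form Var Pred ar)} (hT : IsTheory T) (α : Form Var Pred ar) :
    IsTheory {φ | imp α φ ∈ T} where
  thm_mem h := hT.conseq (hT.thm_mem h) fun v => by simp only [peval_imp]; tauto
  mp_mem h₁ h₂ := hT.conseq₂ h₁ h₂ fun v => by simp only [peval_imp]; tauto

/-- Lindenbaum's lemma. -/
theorem IsTheory.exists_isMaxCons {T : Set (Form Var Pred ar)} (hT : IsTheory T)
    {ψ : Form Var Pred ar} (hψ : ψ ∉ T) : ∃ Γ, IsMaxCons Γ ∧ T ⊆ Γ ∧ ψ ∉ Γ := by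
  obtain ⟨Γ, hTΓ, hΓ⟩ := zorn_subset_nonempty {S : Set (Form Var Pred ar) | IsTheory S ∧ ψ ∉ S}
    (fun c hc hchain hne => by
      refine ⟨⋃₀ c, ⟨⟨fun h => ?_, fun {φ χ} h₁ h₂ => ?_⟩, ?_⟩,
        fun s hs => Set.subset_sUnion_of_mem hs⟩
      · obtain ⟨s, hs⟩ := hne
        exact ⟨s, hs, (hc hs).1.thm_mem h⟩
      · obtain ⟨s, hs, h₁⟩ := h₁
        obtain ⟨t, ht, h₂⟩ := h₂
        rcases hchain.total hs ht with hst | hst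
        · exact ⟨t, ht, (hc ht).1.mp_mem (hst h₁) h₂⟩
        · exact ⟨s, hs, (hc hs).1.mp_mem h₁ (hst h₂)⟩
      · rintro ⟨s, hs, h⟩
        exact (hc hs).2 h) T ⟨hT, hψ⟩
  obtain ⟨hΓT, hψΓ⟩ := hΓ.prop
  -- By maximality, adjoining any new α must produce ψ.
  have key : ∀ α, α ∉ Γ → imp α ψ ∈ Γ := by
    intro α hα
    by_contra hn
    have hsub : Γ ⊆ {φ | imp α φ ∈ Γ} := fun φ h =>
      hΓT.conseq h fun v => by simp only [peval_imp]; tauto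
    refine hα (hΓ.le_of_ge ⟨hΓT.adjoin α, hn⟩ hsub ?_)
    exact hΓT.thm_mem (taut fun v => by simp only [peval_imp]; tauto)
  refine ⟨Γ, ⟨hΓT, fun {φ} => ⟨fun h h' => ?_, fun h => ?_⟩⟩, hTΓ, hψΓ⟩
  · exact hψΓ (hΓT.conseq₂ h h' fun v => by simp only [peval_neg]; tauto)
  · by_contra hn
    exact hψΓ (hΓT.conseq₂ (key _ h) (key _ hn) fun v => by
      simp only [peval_imp, peval_neg]; tauto)

theorem IsMaxCons.and_mem {Γ : Set (Form Var Pred ar)} (hΓ : IsMaxCons Γ)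
    {φ ψ : Form Var Pred ar} : and φ ψ ∈ Γ ↔ φ ∈ Γ ∧ ψ ∈ Γ :=
  ⟨fun h => ⟨hΓ.conseq h fun v => by simp only [peval_and]; tauto,
    hΓ.conseq h fun v => by simp only [peval_and]; tauto⟩,
   fun h => hΓ.conseq₂ h.1 h.2 fun v => by simp only [peval_and]; tauto⟩

theorem IsMaxCons.isTheory_K {Γ : Set (Form Var Pred ar)} (hΓ : IsMaxCons Γ) :
    IsTheory {φ | K φ ∈ Γ} where
  thm_mem h := hΓ.thm_mem (nec h)
  mp_mem h₁ h₂ := hΓ.mp_mem (hΓ.mp_mem (hΓ.thm_mem (dist axDist_subset_S5 _ _)) h₁) h₂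

/-- A formula that is not known fails in some maximal consistent set with the same knowledge. -/
theorem IsMaxCons.exists_notMem {Γ : Set (Form Var Pred ar)} (hΓ : IsMaxCons Γ)
    {ψ : Form Var Pred ar} (hψ : K ψ ∉ Γ) :
    ∃ Δ, IsMaxCons Δ ∧ (∀ χ, K χ ∈ Δ ↔ K χ ∈ Γ) ∧ ψ ∉ Δ := by
  obtain ⟨Δ, hΔ, hsub, hn⟩ := hΓ.isTheory_K.exists_isMaxCons hψ
  -- Axiom 4 transfers what `Γ` knows to `Δ`; axiom 5 transfers what `Γ` does not know.
  refine ⟨Δ, hΔ, fun χ => ⟨fun h => ?_, fun h => hsub (hΓ.mp_mem (hΓ.thm_mem (.axFour χ)) h)⟩, hn⟩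
  by_contra h'
  exact hΔ.neg_mem.1 (hsub (hΓ.mp_mem (hΓ.thm_mem (.axFive χ)) (hΓ.neg_mem.2 h'))) h

/-- Adding a fresh witness preserves consistency. -/
theorem Thm.neg_of_neg_witness {x y : Var} {c θ : Form Var Pred ar} (hc : y ∉ fv c)
    (hy : y ∉ fv θ) (hb : y ∉ bv θ)
    (h : Thm (neg (and c (imp (wh x θ) (K (Form.subst x y θ)))))) : Thm (neg c) := by
  have h₁ : Thm (imp (K (Form.subst x y θ)) (neg c)) := conseq h fun v => by
    simp only [peval_imp, peval_neg, peval_and]; tauto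
  -- The fresh `y` is the variable eliminated; `Thm.wh_rename` then brings back the bound variable
  -- `x`.
  have h₂ := wh_elim (x := y) (ψ := neg c) hc h₁
  refine conseq₃ h h₂ (Thm.wh_rename (x := x) hy hb) fun v => ?_
  simp only [peval_imp, peval_neg, peval_and]
  tauto

/-- Given countably many formulas `[K_wh]^x θ`, a consistent formula belongs to a maximal
consistent set with witnesses from the infinite set `D` for them. -/
theorem exists_isMaxCons_witness {D : Set Var} (hD : D.Infinite)
    {F : Set (Var × Form Var Pred ar)} (hF : F.Countable) {φ : Form Var Pred ar} (hφ : ¬ Thm φ) :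
    ∃ Γ, IsMaxCons Γ ∧ φ ∉ Γ ∧
      ∀ p ∈ F, wh p.1 p.2 ∈ Γ → ∃ y ∈ D, K (subst p.1 y p.2) ∈ Γ := by
  classical
  -- Each stage of the construction is a single formula, so only finitely many variables must be
  -- avoided and an infinite `D` suffices, even if it contains free variables of φ.
  have fresh : ∀ c θ : Form Var Pred ar, ∃ y ∈ D, y ∉ fv c ∧ y ∉ fv θ ∧ y ∉ bv θ := by
    intro c θ
    obtain ⟨y, hy, hn⟩ := hD.exists_notMem_finite
      (((finite_fv c).union (finite_fv θ)).union (finite_bv θ))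
    simp only [Set.mem_union, not_or] at hn
    exact ⟨y, hy, hn.1.1, hn.1.2, hn.2⟩
  choose y hyD hyc hyθ hyb using fresh
  rcases F.eq_empty_or_nonempty with rfl | hne
  · obtain ⟨Γ, hΓ, -, h⟩ := IsTheory.exists_isMaxCons
      (T := {ψ : Form Var Pred ar | Thm ψ}) ⟨fun h => h, fun h h' => mp h h'⟩ hφ
    exact ⟨Γ, hΓ, h, by simp⟩
  obtain ⟨e, rfl⟩ := hF.exists_eq_range hne
  let step (c : Form Var Pred ar) (p : Var × Form Var Pred ar) : Form Var Pred ar :=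
    and c (imp (wh p.1 p.2) (K (subst p.1 (y c p.2) p.2)))
  let c : ℕ → Form Var Pred ar := fun n => Nat.rec (neg φ) (fun n c => step c (e n)) n
  have hcons : ∀ n, ¬ Thm (neg (c n)) := by
    intro n
    induction n with
    | zero => exact fun h => hφ (conseq h fun v => by simp [c])
    | succ n ih => exact fun h => ih (Thm.neg_of_neg_witness (hyc _ _) (hyθ _ _) (hyb _ _) h)
  have hmono : ∀ {m n}, m ≤ n → Thm (imp (c n) (c m)) := by
    intro m n hmn
    induction hmn with
    | refl => exact taut fun v => by simp
    | @step n _ ih =>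
      have : Thm (imp (c (n + 1)) (c n)) := taut fun v => by
        simp only [c, step, peval_imp, peval_and]; tauto
      exact trans this ih
  have hT : IsTheory {ψ | ∃ n, Thm (imp (c n) ψ)} := by
    refine ⟨fun h => ⟨0, conseq h fun v => by simp only [peval_imp]; tauto⟩, ?_⟩
    rintro α β ⟨m, hm⟩ ⟨n, hn⟩
    refine ⟨max m n, conseq₂ (trans (hmono (le_max_left m n)) hm)
      (trans (hmono (le_max_right m n)) hn) fun v => ?_⟩
    simp only [peval_imp]
    tauto
  have hφT : φ ∉ {ψ | ∃ n, Thm (imp (c n) ψ)} := by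
    rintro ⟨n, hn⟩
    have h₀ : Thm (imp (c n) (neg φ)) := hmono (Nat.zero_le n)
    exact hcons n (conseq₂ hn h₀ fun v => by simp only [peval_imp, peval_neg]; tauto)
  obtain ⟨Γ, hΓ, hsub, hn⟩ := hT.exists_isMaxCons hφT
  refine ⟨Γ, hΓ, hn, ?_⟩
  rintro _ ⟨n, rfl⟩ hwh
  refine ⟨y (c n) (e n).2, hyD _ _, hΓ.mp_mem (hsub ⟨n + 1, taut fun v => ?_⟩) hwh⟩
  simp only [c, step, peval_imp, peval_and]
  tauto

/-- The instances `(x, θσ)` of the subformulas `[K_wh]^x θ` of `φ`, for `σ` with values in `D`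
except that `x` is fixed. -/
def whInstances (D : Set Var) (φ : Form Var Pred ar) : Set (Var × Form Var Pred ar) :=
  {q | ∃ p ∈ whSub φ, ∃ σ : Var → Var, (∀ z, σ z ∈ D) ∧
    q = (p.1, rename (Function.update σ p.1 p.1) p.2)}

/-- There are finitely many subformulas, each with countably many renamings. The binder is kept
fixed and need not lie in `D`, so the renamings take values in `D ∪ bv φ`. -/
theorem countable_whInstances {D : Set Var} (hD : D.Countable) (φ : Form Var Pred ar) :
    (whInstances D φ).Countable := by
  have hV : (D ∪ bv φ).Countable := hD.union (finite_bv φ).countable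
  have : (⋃ p ∈ whSub φ, (fun χ => (p.1, χ)) ''
      {χ | ∃ σ : Var → Var, (∀ z, σ z ∈ D ∪ bv φ) ∧ χ = rename σ p.2}).Countable := by
    refine (finite_whSub φ).countable.biUnion fun p hp => ?_
    have hsub := bv_subset_of_mem_whSub hp
    exact (countable_rename hV p.2
      (((Set.subset_insert _ _).trans hsub).trans Set.subset_union_right)).image _
  refine this.mono ?_
  rintro _ ⟨p, hp, σ, hσ, rfl⟩
  refine Set.mem_biUnion hp ⟨_, ⟨Function.update σ p.1 p.1, fun z => ?_, rfl⟩, rfl⟩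
  by_cases hz : z = p.1
  · simpa [hz] using Or.inr (bv_subset_of_mem_whSub hp (Set.mem_insert _ _))
  · simpa [hz] using Or.inl (hσ z)

/-- The model of the maximal consistent sets with the same knowledge as `Γ`, with the variables in
`D` as individuals. -/
def canonicalModel (Γ : Set (Form Var Pred ar)) (hΓ : IsMaxCons Γ) (D : Set Var)
    (hD : D.Nonempty) : Model Pred ar where
  W := {Δ : Set (Form Var Pred ar) // IsMaxCons Δ ∧ ∀ χ, K χ ∈ Δ ↔ K χ ∈ Γ}
  D := D
  nonempty_W := ⟨⟨Γ, hΓ, fun _ => Iff.rfl⟩⟩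
  nonempty_D := hD.to_subtype
  R _ _ := True
  ρ p w := {a | atom p (fun i => (a i : Var)) ∈ w.1}

/-- Truth lemma: an assignment acts as a renaming of variables into `D`, and since `D` avoids the
bound variables no capture occurs. All worlds share the knowledge of `Γ`, so witnesses are required
only there. -/
theorem canonicalModel_sat {Γ : Set (Form Var Pred ar)} (hΓ : IsMaxCons Γ) {D : Set Var}
    (hD : D.Nonempty) {φ : Form Var Pred ar} (hbv : ∀ z ∈ bv φ, z ∉ D)
    (hwit : ∀ p ∈ whInstances D φ, wh p.1 p.2 ∈ Γ → ∃ y ∈ D, K (subst p.1 y p.2) ∈ Γ)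
    (w : (canonicalModel Γ hΓ D hD).W) (σ : Var → D) :
    (canonicalModel Γ hΓ D hD).Sat .KMS φ w σ ↔ rename (fun z => (σ z : Var)) φ ∈ w.1 := by
  have hK : ∀ (w : (canonicalModel Γ hΓ D hD).W) (χ : Form Var Pred ar),
      K χ ∈ w.1 ↔ ∀ v : (canonicalModel Γ hΓ D hD).W, χ ∈ v.1 := by
    intro w χ
    refine ⟨fun h v => v.2.1.mp_mem (v.2.1.thm_mem (.axT χ)) ((v.2.2 χ).2 ((w.2.2 χ).1 h)),
      fun h => ?_⟩
    by_contra hn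
    obtain ⟨Δ, hΔ, hΔΓ, hχ⟩ := hΓ.exists_notMem fun h => hn ((w.2.2 χ).2 h)
    exact hχ (h ⟨Δ, hΔ, hΔΓ⟩)
  induction φ generalizing w σ with
  | atom p ys => rfl
  | neg φ ih => simp only [Model.Sat, rename, ih hbv hwit w σ, w.2.1.neg_mem]
  | and φ ψ ih₁ ih₂ =>
    have h₁ := ih₁ (fun z h => hbv z (Or.inl h))
      (fun p ⟨q, hq, h⟩ => hwit p ⟨q, Or.inl hq, h⟩) w σ
    have h₂ := ih₂ (fun z h => hbv z (Or.inr h))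
      (fun p ⟨q, hq, h⟩ => hwit p ⟨q, Or.inr hq, h⟩) w σ
    simp only [Model.Sat, rename, h₁, h₂, w.2.1.and_mem]
  | K φ ih =>
    have h := fun v => ih hbv hwit v σ
    simp only [Model.Sat, rename, hK w, KHolds, h]
    exact ⟨fun h v => h v trivial, fun h v _ => h v⟩
  | wh x φ ih =>
    have hxD : x ∉ D := hbv x (Or.inl rfl)
    set θ := rename (Function.update (fun z => (σ z : Var)) x x) φ with hθ
    have hbθ : ∀ a : D, (a : Var) ∉ bv θ := fun a h =>
      hbv a (Or.inr (by rwa [hθ, bv_rename] at h)) a.2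
    have hsubst : ∀ a : D, rename (fun z => (Function.update σ x a z : Var)) φ = subst x a θ := by
      intro a
      rw [subst_eq_rename, hθ, rename_rename]
      · refine rename_congr fun z _ => ?_
        by_cases hz : z = x
        · simp [hz]
        · have : (σ z : Var) ≠ x := fun h => hxD (h ▸ (σ z).2)
          simp [hz, this]
      · intro z _ h
        by_cases hz : z = x
        · simp [hz]
        · rw [Function.update_of_ne hz] at h
          exact absurd (σ z).2 (hbv _ (Or.inr h))
    have hsat : ∀ a : D, KHolds (canonicalModel Γ hΓ D hD).R w (fun v =>
        (canonicalModel Γ hΓ D hD).Sat .KMS φ v (Function.update σ x a)) ↔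
        K (subst x a θ) ∈ w.1 := by
      intro a
      rw [hK w, ← hsubst]
      have h := fun v => ih (fun z h => hbv z (Or.inr h))
        (fun p ⟨q, hq, h⟩ => hwit p ⟨q, Or.inr hq, h⟩) v (Function.update σ x a)
      exact ⟨fun h' v => (h v).1 (h' v trivial), fun h' v _ => (h v).2 (h' v)⟩
    constructor
    · rintro ⟨a, ha⟩
      exact w.2.1.mp_mem (w.2.1.thm_mem (Thm.wh_intro (admissible_of_notMem_bv (hbθ a))))
        ((hsat a).1 ha)
    · intro h
      -- Worlds agree only on formulas `K χ`, so `wh x θ` reaches `Γ` through `K (wh x θ)`; the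
      -- witness found there is again a `K`-formula and passes back to `w`.
      have hwh : wh x θ ∈ Γ := hΓ.mp_mem (hΓ.thm_mem (.axT _))
        ((w.2.2 _).1 (w.2.1.mp_mem (w.2.1.thm_mem (Thm.wh_imp_K x θ)) h))
      obtain ⟨a, ha, hKa⟩ := hwit (x, θ)
        ⟨(x, φ), Or.inl rfl, fun z => σ z, fun z => (σ z).2, rfl⟩ hwh
      exact ⟨⟨a, ha⟩, (hsat ⟨a, ha⟩).2 ((w.2.2 _).2 hKa)⟩

/-- Completeness for formulas in which no variable is both free and bound. -/
theorem thm_of_validS5_of_disjoint [Infinite Var] {φ : Form Var Pred ar}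
    (h : ValidS5 .KMS φ) (hdisj : ∀ z ∈ fv φ, z ∉ bv φ) : Thm φ := by
  classical
  by_contra hn
  have hinf : (bv φ)ᶜ.Infinite := (finite_bv φ).infinite_compl
  let e := hinf.natEmbedding
  -- The domain must be countable, infinite and disjoint from `bv φ`; it also contains `fv φ`, so
  -- that the assignment `σ` below fixes the free variables and the renamed formula is φ itself.
  let D : Set Var := Set.range (fun n => (e n : Var)) ∪ fv φ
  have hD : D.Infinite :=
    (Set.infinite_range_of_injective (Subtype.val_injective.comp e.injective)).mono
      Set.subset_union_left
  have hDc : D.Countable := (Set.countable_range _).union (finite_fv φ).countable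
  have hDb : ∀ z ∈ bv φ, z ∉ D := by
    rintro z hz (⟨n, rfl⟩ | hz')
    · exact (e n).2 hz
    · exact hdisj z hz' hz
  obtain ⟨Γ, hΓ, hφ, hwit⟩ := exists_isMaxCons_witness hD (countable_whInstances hDc φ) hn
  obtain ⟨d, hd⟩ := hD.nonempty
  let σ : Var → D := fun z => if hz : z ∈ D then ⟨z, hz⟩ else ⟨d, hd⟩
  have hσ : rename (fun z => (σ z : Var)) φ = φ := by
    conv_rhs => rw [← rename_id φ]
    refine rename_congr fun z hz => ?_
    have : z ∈ D := Or.inr hz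
    simp [σ, this]
  have hsat := h (canonicalModel Γ hΓ D ⟨d, hd⟩)
    ⟨fun _ => trivial, fun _ => trivial, fun _ _ => trivial⟩ ⟨Γ, hΓ, fun _ => Iff.rfl⟩ σ
  have hmem := (canonicalModel_sat hΓ ⟨d, hd⟩ hDb hwit _ σ).1 hsat
  rw [hσ] at hmem
  exact hφ hmem

/-- Completeness of `S5Wh` for the mention-some reading on equivalence relations. -/
theorem thm_of_validS5 [Infinite Var] {φ : Form Var Pred ar} (h : ValidS5 .KMS φ) : Thm φ := by
  induction hn : (fv φ ∩ bv φ).ncard using Nat.strong_induction_on generalizing φ with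
  | _ n ih =>
    by_cases hdisj : ∀ z ∈ fv φ, z ∉ bv φ
    · exact thm_of_validS5_of_disjoint h hdisj
    push Not at hdisj
    obtain ⟨x, hx, hxb⟩ := hdisj
    -- Replacing the free `x` by a fresh `y` preserves validity and removes one variable that is
    -- both free and bound. The theorem obtained is turned back into φ by `Thm.subst`.
    obtain ⟨y, hy⟩ := ((finite_fv φ).union (finite_bv φ)).exists_notMem
    simp only [Set.mem_union, not_or] at hy
    have hbv : bv (subst x y φ) = bv φ := by rw [subst_eq_rename, bv_rename]
    have hsub : fv (subst x y φ) ∩ bv (subst x y φ) ⊂ fv φ ∩ bv φ := by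
      refine ⟨?_, fun h' => ?_⟩
      · rintro z ⟨hz, hzb⟩
        rw [hbv] at hzb
        rw [subst_eq_rename] at hz
        obtain ⟨t, ht, rfl⟩ := fv_rename_subset _ _ hz
        by_cases htx : t = x
        · simp [htx, hy.2] at hzb
        · simpa [htx, ht] using hzb
      · exact notMem_fv_subst (ne_of_mem_of_not_mem hxb hy.2) φ (h' ⟨hx, hxb⟩).1
    have hvalid : ValidS5 .KMS (subst x y φ) := fun M hR w σ =>
      (M.sat_subst .KMS (admissible_of_notMem_bv hy.2) w σ).2 (h M hR w _)
    have hlt := Set.ncard_lt_ncard hsub ((finite_fv φ).inter_of_left _)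
    have := ih _ (hn ▸ hlt) hvalid rfl
    simpa only [subst_subst_cancel hy.1 hy.2] using
      Thm.subst (admissible_subst_cancel hy.1 hy.2) this

end S5

end KnowWh

theorem mainTheorem2 (Var Pred : Type u) (ar : Pred → ℕ) [DecidableEq Var] [Infinite Var]
    (o : KnowWh.WhOp) :
    KnowWh.believed (KnowWh.S42Wh Var Pred ar o) = KnowWh.S5Wh Var Pred ar ∧
    KnowWh.believed (KnowWh.S42Wh Var Pred ar o) = {φ | KnowWh.ValidS5 KnowWh.WhOp.KMS φ} := by
  have h₁ := KnowWh.S5Wh_subset_believed (Var := Var) (Pred := Pred) (ar := ar) o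
  have h₂ := KnowWh.believed_subset_validS5 (Var := Var) (Pred := Pred) (ar := ar) o
  have h₃ : {φ | KnowWh.ValidS5 KnowWh.WhOp.KMS φ} ⊆ KnowWh.S5Wh Var Pred ar :=
    fun _ h => KnowWh.thm_of_validS5 h
  exact ⟨(h₂.trans h₃).antisymm h₁, h₂.antisymm (h₃.trans h₁)⟩
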